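/- Let $M$ be a completely regular Hausdorff space and let $\mathcal{T}(M)$ be the lattice of open subsets of $M$. A quasipoint of $\mathcal{T}(M)$ is a maximal element $\mathfrak{B}$ among the lattice filters (dual ideals) of $\mathcal{T}(M)$ that do not contain $\emptyset$. The Stone spectrum $\mathcal{Q}(\mathcal{T}(M))$ is the set of all quasipoints with the topology that has the sets $\{\mathfrak{B} \mid U \in \mathfrak{B}\}$, $U \in \mathcal{T}(M)$, as a base; it is a compact space. A quasipoint $\mathfrak{B}$ lies over $x \in M$ if $x \in \overline{U}$ for all $U \in \mathfrak{B}$; since $M$ is Hausdorff, it lies over at most one point. Let $\mathcal{Q}^{pt}(\mathcal{T}(M))$ be the set of the quasipoints that lie over some point of $M$, and let $pt : \mathcal{Q}^{pt}(\mathcal{T}(M)) \to M$ map a quasipoint to the point over which it lies. Let $C^{pt}(\mathcal{Q}(\mathcal{T}(M)))$ be the abelian $C^{\ast}$-subalgebra of $C(\mathcal{Q}(\mathcal{T}(M)), \mathbb{C})$ that consists of all continuous functions $\mathcal{Q}(\mathcal{T}(M)) \to \mathbb{C}$ that are constant on each fibre of $pt$. Then the Stone–Čech compactification of $M$ is homeomorphic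 to the Gelfand spectrum of $C^{pt}(\mathcal{Q}(\mathcal{T}(M)))$ (the space of its characters, with the weak-$\ast$ topology). If, in particular, $M$ is discrete, then the Stone–Čech compactification of $M$ is homeomorphic to $\mathcal{Q}(\mathcal{T}(M))$. -/

import Mathlib

open TopologicalSpace Order

/-- The Stone spectrum `Q(L)` of a lattice `L` with least element `⊥`: its points are the
quasipoints of `L`, that is, the maximal elements among the dual ideals (lattice filters) of `L`
that do not contain `⊥`. -/
def StoneSpectrum (L : Type*) [Lattice L] [OrderBot L] : Type _ :=
  {B : PFilter L // Maximal (fun F : PFilter L => ⊥ ∉ F) B}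

namespace StoneSpectrum

section Lattice

variable {L : Type*} [Lattice L] [OrderBot L]

/-- `a ∈ B` for a quasipoint `B` and an element `a` of the lattice. -/
instance : SetLike (StoneSpectrum L) L where
  coe B := (B.1 : Set L)
  coe_injective := fun _ _ h => Subtype.ext (SetLike.coe_injective h)

/-- The set `Q_a(L)` of all quasipoints that contain `a`. -/
def basicOpen (a : L) : Set (StoneSpectrum L) := {B | a ∈ B}

/-- The topology of the Stone spectrum: the sets `Q_a(L)` form a base
(`Q_a ∩ Q_b = Q_{a ⊓ b}`, and every quasipoint is non-empty). -/
instance : TopologicalSpace (StoneSpectrum L) :=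
  generateFrom (Set.range (basicOpen (L := L)))

theorem bot_notMem (B : StoneSpectrum L) : (⊥ : L) ∉ B := B.2.prop

theorem mem_of_le (B : StoneSpectrum L) {a b : L} (hab : a ≤ b) (ha : a ∈ B) : b ∈ B :=
  PFilter.mem_of_le (F := B.1) hab ha

theorem inf_mem (B : StoneSpectrum L) {a b : L} (ha : a ∈ B) (hb : b ∈ B) : a ⊓ b ∈ B :=
  PFilter.inf_mem (F := B.1) ha hb

/-- Every dual ideal that does not contain `⊥` lies in a quasipoint. -/
theorem exists_le (F : PFilter L) (hF : ⊥ ∉ F) : ∃ B : StoneSpectrum L, ∀ a ∈ F, a ∈ B := by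
  obtain ⟨m, hFm, hm⟩ := zorn_le_nonempty₀ {G : PFilter L | ⊥ ∉ G} (fun c hc hchain y hy => by
    refine ⟨IsPFilter.toPFilter (F := ⋃ G ∈ c, (G : Set L)) (IsPFilter.of_def ?_ ?_ ?_), ?_, ?_⟩
    · obtain ⟨a, ha⟩ := y.nonempty
      exact ⟨a, Set.mem_biUnion hy ha⟩
    · intro a ha b hb
      simp only [Set.mem_iUnion, SetLike.mem_coe, exists_prop] at ha hb
      obtain ⟨G, hG, ha⟩ := ha
      obtain ⟨H, hH, hb⟩ := hb
      rcases hchain.total hG hH with h | h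
      · exact ⟨a ⊓ b, Set.mem_biUnion hH (PFilter.inf_mem (h ha) hb), inf_le_left, inf_le_right⟩
      · exact ⟨a ⊓ b, Set.mem_biUnion hG (PFilter.inf_mem ha (h hb)), inf_le_left, inf_le_right⟩
    · intro a b hab ha
      simp only [Set.mem_iUnion, SetLike.mem_coe, exists_prop] at ha ⊢
      obtain ⟨G, hG, ha⟩ := ha
      exact ⟨G, hG, PFilter.mem_of_le hab ha⟩
    · intro h
      obtain ⟨G, hG, h⟩ := Set.mem_iUnion₂.1 (show ⊥ ∈ ⋃ G ∈ c, (G : Set L) from h)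
      exact hc hG h
    · intro G hG a ha
      exact Set.mem_biUnion (s := c) (t := fun G : PFilter L => (G : Set L)) hG ha) F hF
  exact ⟨⟨m, hm⟩, fun a ha => hFm ha⟩

/-- An element that is not in a quasipoint `B` is disjoint from some element of `B`. -/
theorem exists_inf_eq_bot (B : StoneSpectrum L) {a : L} (ha : a ∉ B) :
    ∃ b ∈ B, b ⊓ a = ⊥ := by
  by_contra! h
  obtain ⟨c, hc⟩ : ∃ c : L, c ∈ B := B.1.nonempty
  let G : PFilter L := IsPFilter.toPFilter (F := {x : L | ∃ b ∈ B, b ⊓ a ≤ x})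
    (IsPFilter.of_def ⟨c, c, hc, inf_le_left⟩
      (by
        rintro x ⟨b, hb, hx⟩ y ⟨b', hb', hy⟩
        exact ⟨x ⊓ y, ⟨b ⊓ b', B.inf_mem hb hb', le_inf
          ((inf_le_inf_right _ inf_le_left).trans hx)
          ((inf_le_inf_right _ inf_le_right).trans hy)⟩, inf_le_left, inf_le_right⟩)
      (by
        rintro x y hxy ⟨b, hb, hx⟩
        exact ⟨b, hb, hx.trans hxy⟩))
  have hG : ⊥ ∉ G := by
    rintro ⟨b, hb, hx⟩
    exact h b hb (le_bot_iff.1 hx)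
  have hBG : B.1 ≤ G := fun x hx => ⟨x, hx, inf_le_left⟩
  exact ha (B.2.le_of_ge hG hBG ⟨c, hc, inf_le_right⟩)

end Lattice

/-- The Stone spectrum of a pseudocomplemented distributive lattice, for instance of the lattice
of open sets of a topological space, is compact. -/
instance {L : Type*} [HeytingAlgebra L] : CompactSpace (StoneSpectrum L) := by
  classical
  have key : ∀ (B : StoneSpectrum L) (a : L), a ∉ B → aᶜ ∈ B := by
    intro B a ha
    obtain ⟨b, hb, h⟩ := B.exists_inf_eq_bot ha
    exact B.mem_of_le (le_compl_iff_disjoint_right.2 (disjoint_iff.2 h)) hb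
  have hsup : ∀ (B : StoneSpectrum L) (t : Finset L), (∀ a ∈ t, a ∉ B) → (t.sup id)ᶜ ∈ B := by
    intro B t
    induction t using Finset.induction_on with
    | empty => intro _; rw [Finset.sup_empty, compl_bot]; exact (PFilter.top_mem : (⊤ : L) ∈ B.1)
    | insert a t _ ih =>
      intro h
      rw [Finset.sup_insert, compl_sup]
      exact B.inf_mem (key B a (h a (Finset.mem_insert_self a t)))
        (ih fun b hb => h b (Finset.mem_insert_of_mem hb))
  refine ⟨isCompact_generateFrom rfl fun S hS hcov => ?_⟩
  let G : PFilter L := IsPFilter.toPFilter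
    (F := {x : L | ∃ t : Finset L, (∀ a ∈ t, basicOpen a ∈ S) ∧ (t.sup id)ᶜ ≤ x})
    (IsPFilter.of_def ⟨⊤, ∅, by simp, le_top⟩
      (by
        rintro x ⟨t, ht, hx⟩ y ⟨t', ht', hy⟩
        refine ⟨x ⊓ y, ⟨t ∪ t', fun a ha => ?_, ?_⟩, inf_le_left, inf_le_right⟩
        · exact (Finset.mem_union.1 ha).elim (ht a) (ht' a)
        · rw [Finset.sup_union, compl_sup]
          exact inf_le_inf hx hy)
      (by
        rintro x y hxy ⟨t, ht, hx⟩
        exact ⟨t, ht, hx.trans hxy⟩))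
  by_cases hG : ⊥ ∈ G
  · obtain ⟨t, ht, h⟩ := hG
    refine ⟨(t.image basicOpen : Finset (Set (StoneSpectrum L))), ?_, Finset.finite_toSet _, ?_⟩
    · intro s hs
      obtain ⟨a, ha, rfl⟩ := Finset.mem_image.1 (Finset.mem_coe.1 hs)
      exact ht a ha
    · intro B _
      by_contra hB
      refine B.bot_notMem (B.mem_of_le h (hsup B t fun a ha haB => hB ?_))
      exact Set.mem_sUnion.2 ⟨basicOpen a, Finset.mem_coe.2 (Finset.mem_image_of_mem _ ha), haB⟩
  · exfalso
    obtain ⟨B, hB⟩ := exists_le G hG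
    obtain ⟨s, hs, hBs⟩ := Set.mem_sUnion.1 (hcov (Set.mem_univ B))
    obtain ⟨a, rfl⟩ := hS hs
    have h1 : aᶜ ∈ B := hB _ ⟨{a}, by simpa using hs, by simp⟩
    exact B.bot_notMem (by simpa using B.inf_mem (show a ∈ B from hBs) h1)

end StoneSpectrum

section OpenSets

variable {M : Type*} [TopologicalSpace M]

/-- The set `Q_x(T(M))` of quasipoints over `x`: those quasipoints `B` of the lattice `T(M)` of
open subsets of `M` for which `x` lies in the closure of every `U ∈ B`. -/
def quasipointsOver (x : M) : Set (StoneSpectrum (Opens M)) :=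
  {B | ∀ U ∈ B, x ∈ closure (U : Set M)}

variable (M) in
/-- The set `Q^pt(T(M))` of all quasipoints that lie over some point of `M`. -/
def pointQuasipoints : Set (StoneSpectrum (Opens M)) :=
  ⋃ x : M, quasipointsOver x

/-- The mapping `pt : Q^pt(T(M)) → M` that sends a quasipoint to the point over which it lies. -/
noncomputable def pt (B : pointQuasipoints M) : M :=
  (Set.mem_iUnion.1 B.2).choose

/-- On a Hausdorff space a quasipoint lies over at most one point, so that the fibre of `pt` over
`x` is the set of quasipoints over `x`. -/
theorem pt_eq_iff [T2Space M] (B : pointQuasipoints M) (x : M) :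
    pt B = x ↔ B.1 ∈ quasipointsOver x := by
  have hB : B.1 ∈ quasipointsOver (pt B) := (Set.mem_iUnion.1 B.2).choose_spec
  refine ⟨fun h => h ▸ hB, fun hx => ?_⟩
  by_contra hne
  obtain ⟨U, V, hU, hV, hpU, hxV, hUV⟩ := t2_separation hne
  have hUB : (⟨U, hU⟩ : Opens M) ∉ B.1 := fun h => by
    obtain ⟨z, hzV, hzU⟩ := mem_closure_iff.1 (hx _ h) V hV hxV
    exact Set.disjoint_left.1 hUV hzU hzV
  obtain ⟨W, hW, hWU⟩ := StoneSpectrum.exists_inf_eq_bot B.1 hUB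
  obtain ⟨z, hzU, hzW⟩ := mem_closure_iff.1 (hB _ hW) U hU hpU
  have hz : z ∈ W ⊓ (⟨U, hU⟩ : Opens M) := ⟨hzW, hzU⟩
  rw [hWU] at hz
  exact hz

variable (M) in
/-- `C^pt(Q(T(M)))`: the continuous functions `Q(T(M)) → ℂ` that are constant on each fibre of
`pt : Q^pt(T(M)) → M`, as a unital star-subalgebra of `C(Q(T(M)), ℂ)`. -/
def Cpt : StarSubalgebra ℂ C(StoneSpectrum (Opens M), ℂ) where
  carrier := {f | ∀ B B' : pointQuasipoints M, pt B = pt B' → f B = f B'}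
  mul_mem' hf hg B B' h := by simp [hf B B' h, hg B B' h]
  add_mem' hf hg B B' h := by simp [hf B B' h, hg B B' h]
  algebraMap_mem' _ _ _ _ := rfl
  star_mem' hf B B' h := by simp [hf B B' h]

/-- `C^pt(Q(T(M)))` is closed in `C(Q(T(M)), ℂ)`, hence an abelian C⋆-algebra with respect to the
supremum norm. -/
instance : IsClosed (Cpt M : Set C(StoneSpectrum (Opens M), ℂ)) := by
  have : (Cpt M : Set C(StoneSpectrum (Opens M), ℂ)) =
      ⋂ (B : pointQuasipoints M) (B' : pointQuasipoints M) (_ : pt B = pt B'),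
        {f | f B = f B'} := by
    ext f
    simp [Cpt]
  rw [this]
  exact isClosed_iInter fun B => isClosed_iInter fun B' => isClosed_iInter fun _ =>
    isClosed_eq (continuous_eval_const _) (continuous_eval_const _)

end OpenSets

namespace StoneSpectrum

/-! A quasipoint behaves like an ultrafilter: its image under a continuous map from `M` to a compact
Hausdorff space `K` has a limit, and the limit depends continuously on the quasipoint
(`continuous_quasipointLim`). For `K = βM` this gives a continuous map `q` from the Stone spectrum
to `βM` that sends every quasipoint over `x` to the image of `x`. It is onto, because its compact
range contains the dense image of `M`.

Pullback along `q` therefore embeds `C(βM)` in `Cpt M`. It is onto: `f` in `Cpt M` descends to a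
continuous bounded function on `M` (`exists_continuous_of_mem_Cpt`), which extends to `βM`, and its
pullback agrees with `f` on the dense set of quasipoints that lie over points. So `Cpt M` has the
character space of `C(βM)`, which is `βM`. For discrete `M`, `q` is also injective, hence a
homeomorphism from a compact space to a Hausdorff one. -/

theorem mem_of_forall_inf_ne_bot {L : Type*} [Lattice L] [OrderBot L] (B : StoneSpectrum L)
    {a : L} (h : ∀ b ∈ B, b ⊓ a ≠ ⊥) : a ∈ B := by
  by_contra ha
  obtain ⟨b, hb, hba⟩ := B.exists_inf_eq_bot ha
  exact h b hb hba

theorem top_mem {L : Type*} [Lattice L] [BoundedOrder L] (B : StoneSpectrum L) : (⊤ : L) ∈ B := by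
  obtain ⟨c, hc⟩ : ∃ c : L, c ∈ B := B.1.nonempty
  exact B.mem_of_le le_top hc

theorem isOpen_basicOpen {L : Type*} [Lattice L] [OrderBot L] (a : L) :
    IsOpen (basicOpen a) :=
  isOpen_generateFrom_of_mem ⟨a, rfl⟩

theorem isTopologicalBasis_basicOpen {L : Type*} [Lattice L] [BoundedOrder L] :
    IsTopologicalBasis (Set.range (basicOpen (L := L))) where
  exists_subset_inter := by
    rintro _ ⟨a, rfl⟩ _ ⟨b, rfl⟩ B ⟨ha, hb⟩
    exact ⟨_, ⟨a ⊓ b, rfl⟩, B.inf_mem ha hb, fun C hC =>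
      ⟨C.mem_of_le inf_le_left hC, C.mem_of_le inf_le_right hC⟩⟩
  sUnion_eq := Set.eq_univ_of_forall fun B => ⟨_, ⟨⊤, rfl⟩, B.top_mem⟩
  eq_generateFrom := rfl

theorem isClosed_basicOpen {L : Type*} [Lattice L] [OrderBot L] (a : L) :
    IsClosed (basicOpen a) := by
  refine ⟨isOpen_iff_mem_nhds.2 fun B hB => ?_⟩
  obtain ⟨b, hb, hba⟩ := B.exists_inf_eq_bot hB
  refine Filter.mem_of_superset ((isOpen_basicOpen b).mem_nhds hb) fun C hC hCa => ?_
  exact C.bot_notMem (hba ▸ C.inf_mem hC hCa)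

/-- The open neighbourhoods of a point belong to a common quasipoint. -/
theorem exists_forall_mem_of_point {M : Type*} [TopologicalSpace M] (x : M) :
    ∃ B : StoneSpectrum (Opens M), ∀ V : Opens M, x ∈ V → V ∈ B := by
  let F : PFilter (Opens M) := IsPFilter.toPFilter (F := {V : Opens M | x ∈ V})
    (IsPFilter.of_def ⟨⊤, Opens.mem_top x⟩
      (fun V hV W hW => ⟨V ⊓ W, ⟨hV, hW⟩, inf_le_left, inf_le_right⟩)
      (fun hVW hV => hVW hV))
  exact exists_le F fun h => h

end StoneSpectrum

/-! ### Convergence of quasipoints -/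

section Limit

open StoneSpectrum

variable {M : Type*} [TopologicalSpace M]

/-- By maximality an open set that meets every member of `B` belongs to `B`. Lying over `x` thus
means converging to `x`. -/
theorem mem_quasipointsOver_iff {x : M} {B : StoneSpectrum (Opens M)} :
    B ∈ quasipointsOver x ↔ ∀ V : Opens M, x ∈ V → V ∈ B := by
  refine ⟨fun h V hV => B.mem_of_forall_inf_ne_bot fun U hU hUV => ?_, fun h U hU => ?_⟩
  · obtain ⟨z, hzV, hzU⟩ := mem_closure_iff.1 (h U hU) V V.2 hV
    have hz : z ∈ U ⊓ V := ⟨hzU, hzV⟩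
    rw [hUV] at hz
    exact hz
  · refine mem_closure_iff.2 fun V hV hxV => ?_
    by_contra hne
    have hVU : (⟨V, hV⟩ : Opens M) ⊓ U = ⊥ :=
      Opens.ext (Set.not_nonempty_iff_eq_empty.1 hne)
    exact B.bot_notMem (hVU ▸ B.inf_mem (h ⟨V, hV⟩ hxV) hU)

theorem quasipointsOver_nonempty (x : M) : (quasipointsOver x).Nonempty := by
  obtain ⟨B, hB⟩ := exists_forall_mem_of_point x
  exact ⟨B, mem_quasipointsOver_iff.2 hB⟩

variable (M) in
theorem dense_pointQuasipoints : Dense (pointQuasipoints M) := by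
  refine isTopologicalBasis_basicOpen.dense_iff.2 ?_
  rintro _ ⟨U, rfl⟩ ⟨B, hB⟩
  obtain ⟨x, hx⟩ : ∃ x, x ∈ U := by
    by_contra! h
    have hU : U = ⊥ := Opens.ext (Set.eq_empty_of_forall_notMem h)
    exact B.bot_notMem (hU ▸ hB)
  obtain ⟨C, hC⟩ := quasipointsOver_nonempty x
  exact ⟨C, mem_quasipointsOver_iff.1 hC U hx, Set.mem_iUnion.2 ⟨x, hC⟩⟩

variable {K : Type*} [TopologicalSpace K] [CompactSpace K] (h : C(M, K))

/-- The image of a quasipoint under a continuous map to a compact space converges. -/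
theorem exists_forall_comap_mem (B : StoneSpectrum (Opens M)) :
    ∃ z : K, ∀ V : Opens K, z ∈ V → Opens.comap h V ∈ B := by
  by_contra! hcon
  choose V hzV hVB using hcon
  choose W hWB hW using fun z => B.exists_inf_eq_bot (hVB z)
  obtain ⟨t, ht⟩ := isCompact_univ.elim_finite_subcover (fun z => (V z : Set K))
    (fun z => (V z).2) fun z _ => Set.mem_iUnion.2 ⟨z, hzV z⟩
  -- This member of `B` is disjoint from finitely many preimages that cover `M`, so it is empty.
  have hmem : t.inf W ∈ B := by
    classical
    clear ht
    induction t using Finset.induction_on with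
    | empty => exact B.top_mem
    | insert a t _ ih => rw [Finset.inf_insert]; exact B.inf_mem (hWB a) ih
  refine B.bot_notMem (B.mem_of_le (fun x hx => ?_) hmem)
  obtain ⟨z, hz, hxz⟩ := Set.mem_iUnion₂.1 (ht (Set.mem_univ (h x)))
  rw [← hW z]
  exact ⟨(Finset.inf_le hz : t.inf W ≤ W z) hx, hxz⟩

/-- The limit in a compact space `K` of a quasipoint of `T(M)` along a continuous map `M → K`. -/
noncomputable def quasipointLim (B : StoneSpectrum (Opens M)) : K :=
  (exists_forall_comap_mem h B).choose

theorem comap_mem_of_quasipointLim_mem {B : StoneSpectrum (Opens M)} {V : Opens K}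
    (hV : quasipointLim h B ∈ V) : Opens.comap h V ∈ B :=
  (exists_forall_comap_mem h B).choose_spec V hV

variable [T2Space K]

theorem quasipointLim_eq_of_mem_quasipointsOver {B : StoneSpectrum (Opens M)} {x : M}
    (hB : B ∈ quasipointsOver x) : quasipointLim h B = h x := by
  by_contra hne
  obtain ⟨U, V, hU, hV, hzU, hxV, hUV⟩ := t2_separation hne
  have h1 := comap_mem_of_quasipointLim_mem h (V := ⟨U, hU⟩) hzU
  have h2 := mem_quasipointsOver_iff.1 hB (Opens.comap h ⟨V, hV⟩) hxV
  refine B.bot_notMem (B.mem_of_le (fun y hy => ?_) (B.inf_mem h1 h2))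
  exact (Set.disjoint_left.1 hUV hy.1 hy.2).elim

/-- Regularity of `K`: let `T` be a closed neighbourhood of the limit of `B`. A quasipoint that
contains the preimage of the interior of `T` cannot have its limit outside `T`, for it would then
also contain the disjoint preimage of the complement. -/
theorem continuous_quasipointLim : Continuous (quasipointLim h) := by
  refine continuous_iff_continuousAt.2 fun B S hS => ?_
  obtain ⟨T, hT, hTc, hTS⟩ := exists_mem_nhds_isClosed_subset hS
  have hB := comap_mem_of_quasipointLim_mem h (B := B) (V := ⟨interior T, isOpen_interior⟩)
    (mem_interior_iff_mem_nhds.2 hT)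
  refine Filter.mem_map.2 <|
    Filter.mem_of_superset ((isOpen_basicOpen _).mem_nhds hB) fun C hC => hTS ?_
  by_contra hCT
  have h2 := comap_mem_of_quasipointLim_mem h (B := C) (V := ⟨Tᶜ, hTc.isOpen_compl⟩) hCT
  refine C.bot_notMem (C.mem_of_le (fun y hy => ?_) (C.inf_mem hC h2))
  exact (hy.2 (interior_subset hy.1)).elim

theorem quasipointLim_surjective (hd : DenseRange h) : Function.Surjective (quasipointLim h) := by
  rw [← Set.range_eq_univ,
    ← (isCompact_range (continuous_quasipointLim h)).isClosed.closure_eq]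
  refine (hd.mono ?_).closure_eq
  rintro _ ⟨x, rfl⟩
  obtain ⟨B, hB⟩ := quasipointsOver_nonempty x
  exact ⟨B, quasipointLim_eq_of_mem_quasipointsOver h hB⟩

end Limit

/-! ### Descent of functions to `M` -/

section Descent

open StoneSpectrum

variable {M : Type*} [TopologicalSpace M] [T2Space M]

/-- A function in `C^pt(Q(T(M)))` descends along `pt` to a continuous function on `M`. -/
theorem exists_continuous_of_mem_Cpt {f : C(StoneSpectrum (Opens M), ℂ)} (hf : f ∈ Cpt M) :
    ∃ g : M → ℂ, Continuous g ∧ ∀ x, ∀ B ∈ quasipointsOver x, f B = g x := by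
  choose s hs using quasipointsOver_nonempty (M := M)
  have hfs : ∀ x, ∀ B ∈ quasipointsOver x, f B = f (s x) := fun x B hB =>
    hf ⟨B, Set.mem_iUnion.2 ⟨x, hB⟩⟩ ⟨s x, Set.mem_iUnion.2 ⟨x, hs x⟩⟩
      (((pt_eq_iff _ x).2 hB).trans ((pt_eq_iff _ x).2 (hs x)).symm)
  refine ⟨fun x => f (s x), continuous_iff_continuousAt.2 fun x S hS => ?_, hfs⟩
  obtain ⟨S', hS'S, hS', hxS'⟩ := mem_nhds_iff.1 hS
  -- The intersection is the fibre over `x`, on which `f` is constant. Its terms form a directed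
  -- family of compact closed sets, so a single one already lies in the open set `f ⁻¹' S'`.
  have hinter : ⋂ U : {U : Opens M // x ∈ U}, basicOpen U.1 ⊆ f ⁻¹' S' := fun B hB => by
    have : B ∈ quasipointsOver x :=
      mem_quasipointsOver_iff.2 fun V hV => Set.mem_iInter.1 hB ⟨V, hV⟩
    rw [Set.mem_preimage, hfs x B this]
    exact hxS'
  have : Nonempty {U : Opens M // x ∈ U} := ⟨⟨⊤, Opens.mem_top x⟩⟩
  obtain ⟨⟨U, hxU⟩, hU⟩ := exists_subset_nhds_of_isCompact'
    (V := fun U : {U : Opens M // x ∈ U} => basicOpen U.1)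
    (fun U V => ⟨⟨U.1 ⊓ V.1, U.2, V.2⟩, fun B hB => B.mem_of_le inf_le_left hB,
      fun B hB => B.mem_of_le inf_le_right hB⟩)
    (fun U => (isClosed_basicOpen U.1).isCompact) (fun U => isClosed_basicOpen U.1)
    (U := f ⁻¹' S') fun B hB => (hS'.preimage f.continuous).mem_nhds (hinter hB)
  exact Filter.mem_map.2 <| Filter.mem_of_superset (U.2.mem_nhds hxU) fun y hy =>
    hS'S (hU (mem_quasipointsOver_iff.1 (hs y) U hy))

end Descent

/-! ### Comparison with the Stone–Čech compactification -/

section StoneCech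

open StoneSpectrum

variable (M : Type*) [TopologicalSpace M]

/-- The continuous surjection of the Stone spectrum of `T(M)` onto the Stone–Čech
compactification of `M`. -/
noncomputable def quasipointToStoneCech : C(StoneSpectrum (Opens M), StoneCech M) :=
  ⟨quasipointLim ⟨stoneCechUnit, continuous_stoneCechUnit⟩, continuous_quasipointLim _⟩

theorem quasipointToStoneCech_surjective : Function.Surjective (quasipointToStoneCech M) :=
  quasipointLim_surjective _ denseRange_stoneCechUnit

variable {M}

theorem quasipointToStoneCech_of_mem_quasipointsOver {B : StoneSpectrum (Opens M)} {x : M}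
    (hB : B ∈ quasipointsOver x) : quasipointToStoneCech M B = stoneCechUnit x :=
  quasipointLim_eq_of_mem_quasipointsOver _ hB

/-- The indicator of any `U` is continuous, so it extends to `βM`; the value of the extension at the
image of `B` decides whether `U ∈ B`. -/
theorem quasipointToStoneCech_injective [DiscreteTopology M] :
    Function.Injective (quasipointToStoneCech M) := by
  classical
  have key : ∀ B C : StoneSpectrum (Opens M),
      quasipointToStoneCech M B = quasipointToStoneCech M C → ∀ U ∈ B, U ∈ C := by
    intro B C hBC U hU
    have hc : Continuous fun x : M => decide (x ∈ U) := continuous_of_discreteTopology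
    let e := stoneCechExtend hc
    let V : Opens (StoneCech M) :=
      ⟨e ⁻¹' {e (quasipointToStoneCech M B)},
        (isOpen_discrete _).preimage (continuous_stoneCechExtend hc)⟩
    have hVB := comap_mem_of_quasipointLim_mem ⟨stoneCechUnit, continuous_stoneCechUnit⟩
      (B := B) (V := V) rfl
    have hVC := comap_mem_of_quasipointLim_mem ⟨stoneCechUnit, continuous_stoneCechUnit⟩
      (B := C) (V := V) (congrArg e hBC.symm)
    have hV : ∀ x, stoneCechUnit x ∈ V → decide (x ∈ U) = e (quasipointToStoneCech M B) :=
      fun x hx => (stoneCechExtend_stoneCechUnit hc x).symm.trans hx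
    -- The trace of `V` on `M` lies in both `B` and `C`. For `true` it is contained in `U`; for
    -- `false` it misses `U`, contrary to `U ∈ B`.
    cases he : e (quasipointToStoneCech M B) with
    | true => exact C.mem_of_le (fun x hx => of_decide_eq_true ((hV x hx).trans he)) hVC
    | false =>
      refine (B.bot_notMem (B.mem_of_le (fun x hx => ?_) (B.inf_mem hU hVB))).elim
      exact (of_decide_eq_false ((hV x hx.2).trans he) hx.1).elim
  exact fun B C h => SetLike.ext fun U => ⟨key B C h U, key C B h.symm U⟩

variable [T2Space M]

variable (M) in
/-- The pullback of continuous functions along `quasipointToStoneCech`. -/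
noncomputable def stoneCechPullback : C(StoneCech M, ℂ) →⋆ₐ[ℂ] Cpt M :=
  ((quasipointToStoneCech M).compStarAlgHom' ℂ ℂ).codRestrict (Cpt M) fun g B B' h => by
    have hB := quasipointToStoneCech_of_mem_quasipointsOver ((pt_eq_iff B _).1 rfl)
    have hB' := quasipointToStoneCech_of_mem_quasipointsOver ((pt_eq_iff B' _).1 rfl)
    change g (quasipointToStoneCech M B) = g (quasipointToStoneCech M B')
    rw [hB, hB', h]

theorem stoneCechPullback_bijective : Function.Bijective (stoneCechPullback M) := by
  refine ⟨fun g g' h => ContinuousMap.ext fun z => ?_, fun ⟨f, hf⟩ => ?_⟩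
  · obtain ⟨B, rfl⟩ := quasipointToStoneCech_surjective M z
    exact DFunLike.congr_fun (congrArg Subtype.val h) B
  · obtain ⟨g, hg, hfg⟩ := exists_continuous_of_mem_Cpt hf
    -- The universal property needs a compact target; the range of `f` serves in place of `ℂ`.
    have hmem : ∀ x, g x ∈ Set.range f := fun x => by
      obtain ⟨B, hB⟩ := quasipointsOver_nonempty x
      exact ⟨B, hfg x B hB⟩
    have : CompactSpace (Set.range f) := isCompact_iff_compactSpace.1 (isCompact_range f.continuous)
    have hg' : Continuous (Set.codRestrict g (Set.range f) hmem) := hg.codRestrict hmem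
    let G : C(StoneCech M, ℂ) :=
      ⟨fun z => (stoneCechExtend hg' z).1,
        continuous_subtype_val.comp (continuous_stoneCechExtend hg')⟩
    refine ⟨G, Subtype.ext (ContinuousMap.coe_injective ?_)⟩
    refine Continuous.ext_on (dense_pointQuasipoints M) (ContinuousMap.continuous _)
      f.continuous fun B hB => ?_
    obtain ⟨x, hx⟩ := Set.mem_iUnion.1 hB
    change (stoneCechExtend hg' (quasipointToStoneCech M B)).1 = f B
    rw [quasipointToStoneCech_of_mem_quasipointsOver hx, stoneCechExtend_stoneCechUnit, hfg x B hx]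
    rfl

end StoneCech

open WeakDual.CharacterSpace in
/-- Isomorphic Banach star-algebras have homeomorphic character spaces. -/
noncomputable def StarAlgEquiv.characterSpaceHomeo {𝕜 A B : Type*} [NontriviallyNormedField 𝕜]
    [NormedRing A] [NormedAlgebra 𝕜 A] [CompleteSpace A] [StarRing A]
    [NormedRing B] [NormedAlgebra 𝕜 B] [CompleteSpace B] [StarRing B] (e : A ≃⋆ₐ[𝕜] B) :
    WeakDual.characterSpace 𝕜 A ≃ₜ WeakDual.characterSpace 𝕜 B where
  toFun := compContinuousMap (e.symm : B →⋆ₐ[𝕜] A)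
  invFun := compContinuousMap (e : A →⋆ₐ[𝕜] B)
  left_inv φ := WeakDual.CharacterSpace.ext fun a => congrArg φ (e.symm_apply_apply a)
  right_inv φ := WeakDual.CharacterSpace.ext fun b => congrArg φ (e.apply_symm_apply b)
  continuous_toFun := map_continuous _
  continuous_invFun := map_continuous _

theorem mainTheorem6 (M : Type*) [TopologicalSpace M] [T35Space M] :
    Nonempty (StoneCech M ≃ₜ WeakDual.characterSpace ℂ (Cpt M)) ∧
      (DiscreteTopology M → Nonempty (StoneCech M ≃ₜ StoneSpectrum (Opens M))) := by
  refine ⟨⟨?_⟩, fun _ => ⟨?_⟩⟩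
  -- Completeness makes characters automatically continuous, so a purely algebraic star-isomorphism
  -- suffices.
  · have : CompleteSpace (Cpt M) :=
      (inferInstance : IsClosed (Cpt M : Set C(StoneSpectrum (Opens M), ℂ))).completeSpace_coe
    refine (WeakDual.CharacterSpace.homeoEval (StoneCech M) ℂ).trans ?_
    exact StarAlgEquiv.characterSpaceHomeo (𝕜 := ℂ) (A := C(StoneCech M, ℂ)) (B := Cpt M)
      (StarAlgEquiv.ofBijective (stoneCechPullback M) stoneCechPullback_bijective)
  · exact (Continuous.homeoOfEquivCompactToT2
      (f := Equiv.ofBijective (quasipointToStoneCech M)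
        ⟨quasipointToStoneCech_injective, quasipointToStoneCech_surjective M⟩)
      (map_continuous (quasipointToStoneCech M))).symm
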